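/- Let $C\subseteq\mathbb F_2^n$ be a binary linear code that is projective, i.e. its dual $C^\perp$ (with respect to the Euclidean inner product) has minimum distance at least $3$ (no condition if $C^\perp=0$). Let $A_m$ denote the number of codewords of $C$ of Hamming weight $m$. Suppose that $C$ has exactly three nonzero weights, listed in any order as $w_1,w_2,w_3$, so that its weight enumerator is $1+A_{w_1}z^{w_1}+A_{w_2}z^{w_2}+A_{w_3}z^{w_3}$ with all $A_{w_i}\ne 0$, and put $w_0=0$, $v_i=A_{w_i}$. Suppose further that the distribution matrix of $C^\perp$, whose rows are the weight distributions of all cosets of $C^\perp$ in $\mathbb F_2^n$, has exactly four distinct rows. Then the relations $R_i=\{(x,y)\in C\times C: d_H(x,y)=w_i\}$, $0\le i\le 3$, form a (symmetric) $3$-class association scheme on $C$. Let $p_{ij}^k$ be its intersection numbers: for $(x,y)\in R_k$, $p_{ij}^k=|\{z\in C:(x,z)\in R_i,\ (z,y)\in R_j\}|$. Its valences are $p_{ii}^0=v_i$. For $x,y\in\mathbb F_2^n$ let $d_{10}(x,y)=|\{i:x_i=1,y_i=0\}|$ and $d_{01}(x,y)=|\{i:x_i=0,y_i=1\}|$, and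 for integers $a,b\ge 0$ let $A(a,b)$ be the number of ordered pairs $(x,y)$ of codewords in $C\setminus\{0\}$ with $(d_{10}(x,y),d_{01}(x,y))=(a,b)$. Then $A(0,0)=|C|-1=v_1+v_2+v_3$, and all other values $A(a,b)$ are given by the following table with $21$ rows. $$\begin{array}{c|c} \text{bidistance} & \text{frequency}\\\hline (\frac{w_1}{2},\frac{w_1}{2}) & v_1p_{11}^1+v_2p_{12}^2+v_3p_{13}^3\\ (\frac{w_2}{2},\frac{w_2}{2}) & v_1p_{12}^1+v_2p_{22}^2+v_3p_{23}^3\\ (\frac{w_3}{2},\frac{w_3}{2}) & v_1p_{13}^1+v_2p_{23}^2+v_3p_{33}^3\\\hline (\frac{w_1+w_3-w_2}{2},\frac{w_2+w_3-w_1}{2}) & v_1v_2-v_1p_{12}^1-v_2p_{12}^2\\ (\frac{w_1+w_2-w_3}{2},\frac{w_2+w_3-w_1}{2}) & v_1v_2-v_1p_{12}^1-v_2p_{12}^2\\ (\frac{w_1+w_2-w_3}{2},\frac{w_1+w_3-w_2}{2}) & v_1v_2-v_1p_{12}^1-v_2p_{12}^2\\ (w_1-\frac{w_2}{2},\frac{w_2}{2})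 & v_1p_{12}^1\\ (w_1-\frac{w_3}{2},\frac{w_3}{2}) & v_1p_{13}^1\\ (\frac{w_1}{2},w_2-\frac{w_1}{2}) & v_2p_{12}^2\\ (\frac{w_1}{2},w_3-\frac{w_1}{2}) & v_3p_{13}^3\\ (w_2-\frac{w_3}{2},\frac{w_3}{2}) & v_2p_{23}^2\\ (\frac{w_2}{2},w_3-\frac{w_2}{2}) & v_3p_{23}^3 \end{array}$$ The remaining nine rows are the last nine rows displayed, with the two components of the bidistance interchanged and with the same frequency. Precisely: for all integers $a,b\ge 0$ with $(a,b)\ne(0,0)$, $A(a,b)$ is the sum of the frequencies of those of the $21$ rows whose bidistance equals $(a,b)$ (an empty sum being $0$). Moreover, all frequencies in the table are nonnegative, and every row whose bidistance is not a pair of nonnegative integers has frequency $0$. -/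

import Mathlib

namespace BinaryCode

/-- Binary words of length `n`, that is, vectors in `𝔽₂ⁿ`. -/
abbrev Word (n : ℕ) : Type := Fin n → ZMod 2

/-- `A_i`: the number of codewords of Hamming weight `i` in the code `S`. -/
noncomputable def weightCount {n : ℕ} (S : Set (Word n)) (i : ℕ) : ℕ :=
  Set.ncard {c | c ∈ S ∧ hammingNorm c = i}

/-- The dual code with respect to the Euclidean inner product. -/
def dualCode {n : ℕ} (C : Submodule (ZMod 2) (Word n)) : Submodule (ZMod 2) (Word n) where
  carrier := {u | ∀ c ∈ C, u ⬝ᵥ c = 0}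
  add_mem' := by
    intro a b ha hb c hc
    rw [add_dotProduct, ha c hc, hb c hc, add_zero]
  zero_mem' := by
    intro c _
    exact zero_dotProduct c
  smul_mem' := by
    intro r a ha c hc
    rw [smul_dotProduct, ha c hc, smul_zero]

/-- A linear code is projective if its dual code has minimum distance at least `3`
(no condition if the dual code is zero). -/
def IsProjective {n : ℕ} (C : Submodule (ZMod 2) (Word n)) : Prop :=
  ∀ x ∈ dualCode C, ∀ y ∈ dualCode C, x ≠ y → 3 ≤ hammingDist x y

/-- `C` is a three-weight code, and `w 1, w 2, w 3` list its three distinct nonzero weights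
(in any order), with `w 0 = 0`. -/
structure IsThreeWeight {n : ℕ} (C : Submodule (ZMod 2) (Word n)) (w : Fin 4 → ℕ) : Prop where
  zero : w 0 = 0
  injective : Function.Injective w
  weights : ∀ m : ℕ, weightCount (C : Set (Word n)) m ≠ 0 ↔ ∃ i, w i = m

/-- The distribution matrix of a linear code `D`: the rows are indexed by the cosets of `D`, and
each row records the weight distribution of its coset. -/
noncomputable def distributionMatrix {n : ℕ} (D : Submodule (ZMod 2) (Word n)) :
    Matrix (Word n ⧸ D) (Fin (n + 1)) ℕ :=
  fun q j => weightCount {u : Word n | (Submodule.Quotient.mk u : Word n ⧸ D) = q} j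

/-- The number of distinct rows of the distribution matrix of `D`. -/
noncomputable def numDistinctRows {n : ℕ} (D : Submodule (ZMod 2) (Word n)) : ℕ :=
  Set.ncard (Set.range fun q : Word n ⧸ D => (distributionMatrix D).row q)

/-- `R 0, …, R s` form a (symmetric) association scheme with `s` classes on the finite set `X`,
with intersection numbers `p i j k = p_{ij}^k`. -/
structure IsAssociationScheme {X : Type*} {s : ℕ} (R : Fin (s + 1) → X → X → Prop)
    (p : Fin (s + 1) → Fin (s + 1) → Fin (s + 1) → ℕ) : Prop where
  finite : Finite X
  partition : ∀ x y, ∃! i, R i x y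
  nonempty : ∀ i, ∃ x y, R i x y
  diagonal : ∀ x y, R 0 x y ↔ x = y
  symm : ∀ i x y, R i x y ↔ R i y x
  intersection : ∀ i j k x y, R k x y → Set.ncard {z | R i x z ∧ R j z y} = p i j k

/-- The relations of the distance scheme: `R_i = {(c₁, c₂) ∈ C × C : d(c₁, c₂) = w_i}`. -/
def distanceScheme {n : ℕ} (C : Submodule (ZMod 2) (Word n)) (w : Fin 4 → ℕ) :
    Fin (3 + 1) → C → C → Prop :=
  fun i x y => hammingDist (x : Word n) (y : Word n) = w i

/-- The number of positions with a `1` in `x` and a `0` in `y`. -/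
def d10 {n : ℕ} (x y : Word n) : ℕ :=
  (Finset.univ.filter fun i => x i = 1 ∧ y i = 0).card

/-- The number of positions with a `0` in `x` and a `1` in `y`. -/
def d01 {n : ℕ} (x y : Word n) : ℕ :=
  (Finset.univ.filter fun i => x i = 0 ∧ y i = 1).card

/-- The asymmetric Hamming bidistance. -/
def bidistance {n : ℕ} (x y : Word n) : ℕ × ℕ := (d10 x y, d01 x y)

/-- The bidistance distribution `A(a, b)` of the code `S`: the number of ordered pairs of
codewords with asymmetric Hamming bidistance `(a, b)`. -/
noncomputable def bidistanceFreq {n : ℕ} (S : Set (Word n)) (a b : ℕ) : ℕ :=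
  Set.ncard {xy : Word n × Word n | xy.1 ∈ S ∧ xy.2 ∈ S ∧ bidistance xy.1 xy.2 = (a, b)}

/-- The three rows of the table whose bidistance has equal components. Each row consists of a
bidistance and a frequency; `v i` are the valences and `p i j k = p_{ij}^k`. -/
def diagonalRows (w v : Fin 4 → ℕ) (p : Fin 4 → Fin 4 → Fin 4 → ℕ) : List ((ℚ × ℚ) × ℤ) :=
  [ (((w 1 : ℚ) / 2, (w 1 : ℚ) / 2),
      (v 1 : ℤ) * p 1 1 1 + (v 2 : ℤ) * p 1 2 2 + (v 3 : ℤ) * p 1 3 3),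
    (((w 2 : ℚ) / 2, (w 2 : ℚ) / 2),
      (v 1 : ℤ) * p 1 2 1 + (v 2 : ℤ) * p 2 2 2 + (v 3 : ℤ) * p 2 3 3),
    (((w 3 : ℚ) / 2, (w 3 : ℚ) / 2),
      (v 1 : ℤ) * p 1 3 1 + (v 2 : ℤ) * p 2 3 2 + (v 3 : ℤ) * p 3 3 3) ]

/-- The nine further rows that the table displays. -/
def offDiagonalRows (w v : Fin 4 → ℕ) (p : Fin 4 → Fin 4 → Fin 4 → ℕ) : List ((ℚ × ℚ) × ℤ) :=
  [ ((((w 1 : ℚ) + w 3 - w 2) / 2, ((w 2 : ℚ) + w 3 - w 1) / 2),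
      (v 1 : ℤ) * v 2 - (v 1 : ℤ) * p 1 2 1 - (v 2 : ℤ) * p 1 2 2),
    ((((w 1 : ℚ) + w 2 - w 3) / 2, ((w 2 : ℚ) + w 3 - w 1) / 2),
      (v 1 : ℤ) * v 2 - (v 1 : ℤ) * p 1 2 1 - (v 2 : ℤ) * p 1 2 2),
    ((((w 1 : ℚ) + w 2 - w 3) / 2, ((w 1 : ℚ) + w 3 - w 2) / 2),
      (v 1 : ℤ) * v 2 - (v 1 : ℤ) * p 1 2 1 - (v 2 : ℤ) * p 1 2 2),
    (((w 1 : ℚ) - (w 2 : ℚ) / 2, (w 2 : ℚ) / 2), (v 1 : ℤ) * p 1 2 1),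
    (((w 1 : ℚ) - (w 3 : ℚ) / 2, (w 3 : ℚ) / 2), (v 1 : ℤ) * p 1 3 1),
    (((w 1 : ℚ) / 2, (w 2 : ℚ) - (w 1 : ℚ) / 2), (v 2 : ℤ) * p 1 2 2),
    (((w 1 : ℚ) / 2, (w 3 : ℚ) - (w 1 : ℚ) / 2), (v 3 : ℤ) * p 1 3 3),
    (((w 2 : ℚ) - (w 3 : ℚ) / 2, (w 3 : ℚ) / 2), (v 2 : ℤ) * p 2 3 2),
    (((w 2 : ℚ) / 2, (w 3 : ℚ) - (w 2 : ℚ) / 2), (v 3 : ℤ) * p 2 3 3) ]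

/-- The full table with its 21 rows: the nine off-diagonal rows occur a second time with the two
components of the bidistance interchanged and the same frequency. -/
def bidistanceTable (w v : Fin 4 → ℕ) (p : Fin 4 → Fin 4 → Fin 4 → ℕ) :
    List ((ℚ × ℚ) × ℤ) :=
  diagonalRows w v p ++ offDiagonalRows w v p ++
    (offDiagonalRows w v p).map fun r => (r.1.swap, r.2)

/-- The frequency that a table assigns to the bidistance `(a, b)`. Rows of the table whose
bidistances coincide contribute the sum of their frequencies. -/
def tableFreq (T : List ((ℚ × ℚ) × ℤ)) (a b : ℕ) : ℤ :=
  ((T.filter fun r => decide (r.1 = ((a : ℚ), (b : ℚ)))).map Prod.snd).sum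

end BinaryCode

/-!
The proof has two independent parts.

**The scheme.** For a word `x`, consider the vector of character sums `∑ (-1) ^ (x ⬝ c)` over the
codewords `c` of each of the four weights. By Poisson summation over the coset `x + C^⊥`, and
because Krawtchouk sums depend only on the weight (`krawtchouk_eq_of_hammingNorm_eq`), the weight
distribution of the coset determines this vector (`charSum_eq_of_row_eq`). So at most four such
vectors occur. The four coordinates, as functions on this set of at most four points, are linearly
independent, since the Fourier transform is injective (`eq_zero_of_fourier_eq_zero`). Hence they
span all functions on it, and the product of any two of them is a linear combination of the four
(`exists_charSum_mul_eq`). Transforming back, the convolution of the indicators of two weight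
classes is constant on each weight class, which says that the intersection numbers exist
(`exists_card_decomposition`).

**The table.** The weights of `x` and `y` together with their distance determine the bidistance of
`(x, y)`: its two components have sum `d(x, y)` and difference `wt(x) - wt(y)`. For
`(a, b) ≠ (0, 0)`, the frequency of `(a, b)` is therefore the sum of the numbers `triangleCount` of
pairs with prescribed weights and distance, over the 27 triples of nonzero weights
(`bidistanceFreq_eq_sum`). These numbers are symmetric in the three indices, because `0, x, y` can
be translated to `x, 0, x - y`, and they equal `v_k p_{ij}^k` (`triangleCount_eq_mul`). The nine
triples with equal first two indices merge into the three diagonal rows, the other eighteen are the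
remaining rows; the number of triangles with three distinct weights is what the isosceles triangles
leave of all pairs of codewords of weights `w₁` and `w₂` (`offDiagonalRows_eq`).
-/

namespace BinaryCode

/-! ### Characters of binary words -/

/-- The nontrivial additive character `a ↦ (-1) ^ a` of `𝔽₂`, with rational values. -/
def signChar (a : ZMod 2) : ℚ := if a = 0 then 1 else -1

theorem signChar_zero : signChar 0 = 1 := rfl

theorem signChar_of_ne_zero {a : ZMod 2} (h : a ≠ 0) : signChar a = -1 := if_neg h

theorem signChar_add (a b : ZMod 2) : signChar (a + b) = signChar a * signChar b := by
  have h : ∀ a b : ZMod 2, a ≠ 0 → b ≠ 0 → a + b = 0 := by decide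
  unfold signChar
  by_cases ha : a = 0
  · simp [ha]
  · by_cases hb : b = 0
    · simp [hb]
    · simp [ha, hb, h a b ha hb]

theorem sum_signChar_eq_zero {n : ℕ} (D : Submodule (ZMod 2) (Word n)) [Fintype D] {c : Word n}
    (h : ∃ d ∈ D, d ⬝ᵥ c ≠ 0) : ∑ d : D, signChar ((d : Word n) ⬝ᵥ c) = 0 := by
  obtain ⟨e, he, hec⟩ := h
  -- Translation by `e` changes the sign of the sum.
  have key : ∑ d : D, signChar ((d : Word n) ⬝ᵥ c) = ∑ d : D, -signChar ((d : Word n) ⬝ᵥ c) := by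
    rw [← Equiv.sum_comp (Equiv.addRight (⟨e, he⟩ : D))]
    refine Finset.sum_congr rfl fun d _ => ?_
    simp [add_dotProduct, signChar_add, signChar_of_ne_zero hec]
  rw [Finset.sum_neg_distrib] at key
  linarith

theorem exists_dotProduct_ne_zero {n : ℕ} {c : Word n} (h : c ≠ 0) : ∃ x : Word n, x ⬝ᵥ c ≠ 0 := by
  obtain ⟨i, hi⟩ := Function.ne_iff.mp h
  exact ⟨Pi.single i 1, by simpa using hi⟩

theorem sum_signChar_univ {n : ℕ} (c : Word n) :
    ∑ x : Word n, signChar (x ⬝ᵥ c) = if c = 0 then (2 : ℚ) ^ n else 0 := by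
  split_ifs with h
  · subst h
    simp [signChar_zero]
  · classical
    obtain ⟨e, hec⟩ := exists_dotProduct_ne_zero h
    have := sum_signChar_eq_zero (⊤ : Submodule (ZMod 2) (Word n)) ⟨e, trivial, hec⟩
    rw [← this]
    exact Fintype.sum_equiv (Submodule.topEquiv (R := ZMod 2)).symm.toEquiv _ _ fun x => rfl

theorem add_eq_zero_iff_eq_word {n : ℕ} (x y : Word n) : x + y = 0 ↔ x = y := by
  have h : y = -y := funext fun i => (ZMod.neg_eq_self_mod_two (y i)).symm
  rw [add_eq_zero_iff_eq_neg, ← h]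

/-- The Hamming distance in terms of the difference `x - y` (rather than `-x + y`). -/
theorem hammingDist_eq_hammingNorm_sub {n : ℕ} (x y : Word n) :
    hammingDist x y = hammingNorm (x - y) := by
  simp [hammingDist, hammingNorm, sub_ne_zero]

/-- The Fourier transform is injective on functions on a code. -/
theorem eq_zero_of_fourier_eq_zero {n : ℕ} (C : Submodule (ZMod 2) (Word n)) [Fintype C]
    (f : C → ℚ) (h : ∀ x : Word n, ∑ c : C, f c * signChar (x ⬝ᵥ (c : Word n)) = 0) : f = 0 := by
  classical
  funext c'
  have h1 : ∑ x : Word n, signChar (x ⬝ᵥ (c' : Word n)) *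
      ∑ c : C, f c * signChar (x ⬝ᵥ (c : Word n)) = 0 := by
    simp [h]
  have h2 : ∑ x : Word n, signChar (x ⬝ᵥ (c' : Word n)) *
      ∑ c : C, f c * signChar (x ⬝ᵥ (c : Word n)) = f c' * 2 ^ n := by
    simp_rw [Finset.mul_sum]
    rw [Finset.sum_comm]
    have : ∀ c : C, ∑ x : Word n, signChar (x ⬝ᵥ (c' : Word n)) *
        (f c * signChar (x ⬝ᵥ (c : Word n))) = if c = c' then f c * 2 ^ n else 0 := by
      intro c
      have e : ∀ x : Word n, signChar (x ⬝ᵥ (c' : Word n)) * (f c * signChar (x ⬝ᵥ (c : Word n)))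
          = f c * signChar (x ⬝ᵥ ((c : Word n) + c')) := by
        intro x
        rw [dotProduct_add, signChar_add]
        ring
      simp_rw [e]
      rw [← Finset.mul_sum, sum_signChar_univ]
      simp only [add_eq_zero_iff_eq_word, Subtype.coe_inj]
      split_ifs <;> simp
    simp_rw [this]
    simp
  rw [h1] at h2
  have := h2.symm
  simpa using this

/-- The bidual of a code is the code itself: a word outside `C` is detected by the dual code. -/
theorem exists_mem_dualCode_dotProduct_ne_zero {n : ℕ} (C : Submodule (ZMod 2) (Word n))
    {c : Word n} (hc : c ∉ C) : ∃ d ∈ dualCode C, d ⬝ᵥ c ≠ 0 := by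
  obtain ⟨f, hfc, hf⟩ := Submodule.exists_dual_map_eq_bot_of_notMem hc inferInstance
  have hrep : ∀ x : Word n, (fun i => f (Pi.single i 1)) ⬝ᵥ x = f x := by
    intro x
    conv_rhs => rw [← LinearMap.sum_single_apply (fun _ => ZMod 2) x, map_sum]
    refine Finset.sum_congr rfl fun i _ => ?_
    have : (Pi.single i (x i) : Word n) = x i • Pi.single i 1 := by
      rw [← Pi.single_smul]; simp
    simp [this, mul_comm]
  refine ⟨_, fun x hx => ?_, by rw [hrep]; exact hfc⟩
  rw [hrep]
  have : f x ∈ C.map f := ⟨x, hx, rfl⟩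
  rwa [hf, Submodule.mem_bot] at this

/-! ### Character sums and weight distributions of cosets -/

/-- The character sum `∑ (-1) ^ (x ⬝ c)` over the codewords `c` of weight `m` of the code `C`. -/
def charSum {n : ℕ} (C : Submodule (ZMod 2) (Word n)) [Fintype C] (m : ℕ) (x : Word n) : ℚ :=
  ∑ c : C, if hammingNorm (c : Word n) = m then signChar (x ⬝ᵥ (c : Word n)) else 0

/-- The value at `u` of the Krawtchouk polynomial of degree `m`: the character sum over all words
of weight `m`. -/
def krawtchouk {n : ℕ} (m : ℕ) (u : Word n) : ℚ :=
  ∑ c : Word n, if hammingNorm c = m then signChar (u ⬝ᵥ c) else 0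

theorem exists_perm_of_hammingNorm_eq {n : ℕ} {u u' : Word n} (h : hammingNorm u = hammingNorm u') :
    ∃ σ : Equiv.Perm (Fin n), u' ∘ σ = u := by
  classical
  have hcard : Fintype.card {i // u i ≠ 0} = Fintype.card {i // u' i ≠ 0} := by
    rw [Fintype.card_subtype, Fintype.card_subtype]
    exact h
  let e := Fintype.equivOfCardEq hcard
  refine ⟨e.extendSubtype, funext fun i => ?_⟩
  have two : ∀ a b : ZMod 2, (a ≠ 0 ↔ b ≠ 0) → a = b := by decide
  refine two _ _ ⟨fun hi => ?_, fun hi => e.extendSubtype_mem i hi⟩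
  by_contra hu
  exact e.extendSubtype_not_mem i (by simpa using hu) hi

theorem hammingNorm_comp_perm {n : ℕ} (c : Word n) (σ : Equiv.Perm (Fin n)) :
    hammingNorm (c ∘ σ) = hammingNorm c :=
  Finset.card_bij (fun i _ => σ i) (by simp) (by simp) (fun b hb => ⟨σ.symm b, by simpa using hb⟩)

/-- The Krawtchouk sum at `u` depends on `u` only through its weight. -/
theorem krawtchouk_eq_of_hammingNorm_eq {n : ℕ} (m : ℕ) {u u' : Word n}
    (h : hammingNorm u = hammingNorm u') : krawtchouk m u = krawtchouk m u' := by
  obtain ⟨σ, rfl⟩ := exists_perm_of_hammingNorm_eq h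
  refine (Fintype.sum_equiv (σ.symm.arrowCongr (Equiv.refl (ZMod 2))) _ _ fun c => ?_).symm
  have h1 : (σ.symm.arrowCongr (Equiv.refl (ZMod 2))) c = c ∘ σ := rfl
  have h2 : (u' ∘ σ) ⬝ᵥ (c ∘ σ) = u' ⬝ᵥ c := comp_equiv_dotProduct_comp_equiv _ _ _
  rw [h1, hammingNorm_comp_perm, h2]

/-- Poisson summation for the coset `x + D`, where `D` is the dual code of `C`. -/
theorem sum_krawtchouk_coset {n : ℕ} (C : Submodule (ZMod 2) (Word n)) [Fintype C]
    [Fintype (dualCode C)] (m : ℕ) (x : Word n) :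
    ∑ d : dualCode C, krawtchouk m (x + (d : Word n)) = Fintype.card (dualCode C) * charSum C m x := by
  classical
  unfold krawtchouk charSum
  rw [Finset.sum_comm, Finset.mul_sum]
  have hC : ∀ c : Word n, ∑ d : dualCode C,
      (if hammingNorm c = m then signChar ((x + (d : Word n)) ⬝ᵥ c) else 0) =
      if c ∈ C then (Fintype.card (dualCode C) : ℚ) *
        (if hammingNorm c = m then signChar (x ⬝ᵥ c) else 0) else 0 := by
    intro c
    by_cases hm : hammingNorm c = m
    · simp only [hm, if_true, add_dotProduct, signChar_add]
      rw [← Finset.mul_sum]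
      split_ifs with hc
      · have : ∀ d : dualCode C, signChar ((d : Word n) ⬝ᵥ c) = 1 := fun d => by
          rw [d.2 c hc, signChar_zero]
        simp [this, mul_comm]
      · rw [sum_signChar_eq_zero _ (exists_mem_dualCode_dotProduct_ne_zero C hc), mul_zero]
    · simp [hm]
  simp_rw [hC]
  rw [← Finset.sum_filter]
  exact (Finset.sum_subtype _ (by simp) _)

theorem card_coset_weight {n : ℕ} (D : Submodule (ZMod 2) (Word n)) [Fintype D] (x : Word n)
    (j : ℕ) :
    weightCount {u : Word n | (Submodule.Quotient.mk u : Word n ⧸ D) = Submodule.Quotient.mk x} j =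
      (Finset.univ.filter fun d : D => hammingNorm (x + (d : Word n)) = j).card := by
  unfold weightCount
  rw [← Set.ncard_coe_finset]
  symm
  refine Set.ncard_congr (fun d _ => x + (d : Word n)) ?_ ?_ ?_
  · intro d hd
    refine ⟨?_, by simpa using hd⟩
    simp [Submodule.Quotient.eq]
  · intro a b _ _ hab
    simpa using hab
  · rintro u ⟨hu, hw⟩
    have hu' : u - x ∈ D := (Submodule.Quotient.eq D).mp hu
    exact ⟨⟨u - x, hu'⟩, by simpa using hw, by simp⟩

/-- The weight distribution of the coset `x + C^⊥` determines the character sums at `x`. -/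
theorem charSum_eq_of_row_eq {n : ℕ} (C : Submodule (ZMod 2) (Word n)) [Fintype C] {x y : Word n}
    (h : (distributionMatrix (dualCode C)).row (Submodule.Quotient.mk x) =
      (distributionMatrix (dualCode C)).row (Submodule.Quotient.mk y)) (m : ℕ) :
    charSum C m x = charSum C m y := by
  classical
  obtain ⟨κ, hκ⟩ : ∃ κ : ℕ → ℚ, ∀ u : Word n, krawtchouk m u = κ (hammingNorm u) :=
    ⟨Function.extend (fun u : Word n => hammingNorm u) (krawtchouk m) 0, fun u =>
      (Function.FactorsThrough.extend_apply (g := krawtchouk m)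
        (f := fun u : Word n => hammingNorm u)
        (fun _ _ hab => krawtchouk_eq_of_hammingNorm_eq m hab) _ u).symm⟩
  have hsum : ∀ z : Word n, ∑ d : dualCode C, krawtchouk m (z + (d : Word n)) =
      ∑ j : Fin (n + 1), (distributionMatrix (dualCode C)).row (Submodule.Quotient.mk z) j * κ j := by
    intro z
    have hlt : ∀ u : Word n, hammingNorm u < n + 1 := fun u => by
      simpa [Nat.lt_succ_iff] using (hammingNorm_le_card_fintype (x := u))
    rw [← Finset.sum_fiberwise _ (fun d : dualCode C =>
      (⟨hammingNorm (z + (d : Word n)), hlt _⟩ : Fin (n + 1)))]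
    refine Finset.sum_congr rfl fun j _ => ?_
    simp only [Matrix.row, distributionMatrix]
    rw [card_coset_weight, ← nsmul_eq_mul, ← Finset.sum_const]
    refine Finset.sum_congr (by ext d; simp [Fin.ext_iff]) fun d hd => ?_
    rw [hκ]
    simp only [Finset.mem_filter, Finset.mem_univ, true_and] at hd
    rw [hd]
  have h1 := hsum x
  rw [h, ← hsum y, sum_krawtchouk_coset, sum_krawtchouk_coset] at h1
  exact mul_left_cancel₀ (by exact_mod_cast Fintype.card_ne_zero) h1

/-- There are at most as many vectors of character sums as there are distinct rows. -/
theorem ncard_range_charSum_le {n : ℕ} (C : Submodule (ZMod 2) (Word n)) [Fintype C]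
    {ι : Type*} (w : ι → ℕ) :
    (Set.range fun (x : Word n) (i : ι) => charSum C (w i) x).ncard ≤
      numDistinctRows (dualCode C) := by
  obtain ⟨g, hg⟩ : ∃ g : (Fin (n + 1) → ℕ) → ι → ℚ, ∀ x : Word n,
      g ((distributionMatrix (dualCode C)).row (Submodule.Quotient.mk x)) =
        fun i => charSum C (w i) x := by
    refine ⟨Function.extend (fun x : Word n =>
      (distributionMatrix (dualCode C)).row (Submodule.Quotient.mk x))
      (fun (x : Word n) (i : ι) => charSum C (w i) x) 0, fun x => ?_⟩
    exact Function.FactorsThrough.extend_apply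
      (fun _ _ hab => funext fun i => charSum_eq_of_row_eq C hab (w i)) _ x
  refine (Set.ncard_le_ncard (t := g '' Set.range fun q : Word n ⧸ dualCode C =>
    (distributionMatrix (dualCode C)).row q) ?_ ((Set.finite_range _).image g)).trans
    (Set.ncard_image_le (Set.finite_range _))
  rintro _ ⟨x, rfl⟩
  exact ⟨_, ⟨Submodule.Quotient.mk x, rfl⟩, hg x⟩

/-! ### The association scheme -/

theorem IsThreeWeight.exists_mem {n : ℕ} {C : Submodule (ZMod 2) (Word n)} {w : Fin 4 → ℕ}
    (hw : IsThreeWeight C w) (i : Fin 4) : ∃ c : C, hammingNorm (c : Word n) = w i := by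
  have h := (hw.weights (w i)).mpr ⟨i, rfl⟩
  obtain ⟨c, hc, hci⟩ := Set.nonempty_of_ncard_ne_zero h
  exact ⟨⟨c, hc⟩, hci⟩

theorem IsThreeWeight.exists_weight {n : ℕ} {C : Submodule (ZMod 2) (Word n)} {w : Fin 4 → ℕ}
    (hw : IsThreeWeight C w) (c : C) : ∃ i, hammingNorm (c : Word n) = w i := by
  have h : weightCount (C : Set (Word n)) (hammingNorm (c : Word n)) ≠ 0 :=
    Set.ncard_ne_zero_of_mem (a := (c : Word n)) ⟨c.2, rfl⟩ (Set.toFinite _)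
  obtain ⟨i, hi⟩ := (hw.weights _).mp h
  exact ⟨i, hi.symm⟩

/-- Since there are only four vectors of character sums, every function of such a vector is a linear
combination of its coordinates; in particular so is the product of two coordinates. -/
theorem exists_charSum_mul_eq {n : ℕ} {C : Submodule (ZMod 2) (Word n)} [Fintype C]
    {w : Fin 4 → ℕ} (hw : IsThreeWeight C w) (hrows : numDistinctRows (dualCode C) ≤ 4)
    (i j : Fin 4) :
    ∃ a : Fin 4 → ℚ, ∀ x : Word n,
      charSum C (w i) x * charSum C (w j) x = ∑ k, a k * charSum C (w k) x := by
  classical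
  let Q : Set (Fin 4 → ℚ) := Set.range fun (x : Word n) (i : Fin 4) => charSum C (w i) x
  have hQfin : Q.Finite := Set.finite_range _
  have : Fintype Q := hQfin.fintype
  let T : (Fin 4 → ℚ) →ₗ[ℚ] (Q → ℚ) :=
    { toFun := fun a q => ∑ k, a k * (q : Fin 4 → ℚ) k
      map_add' := fun a b => by
        funext q
        simp [add_mul, Finset.sum_add_distrib]
      map_smul' := fun r a => by
        funext q
        simp [Finset.mul_sum, mul_assoc] }
  have hinj : Function.Injective T := by
    rw [← LinearMap.ker_eq_bot, LinearMap.ker_eq_bot']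
    intro a ha
    have hf := eq_zero_of_fourier_eq_zero C
      (fun c => ∑ k, if hammingNorm (c : Word n) = w k then a k else 0) (fun x => by
        have := congrFun ha ⟨_, x, rfl⟩
        simp only [T, LinearMap.coe_mk, AddHom.coe_mk, Pi.zero_apply, charSum,
          Finset.mul_sum] at this
        rw [Finset.sum_comm] at this
        refine Eq.trans ?_ this
        refine Finset.sum_congr rfl fun c _ => ?_
        rw [Finset.sum_mul]
        refine Finset.sum_congr rfl fun k _ => ?_
        split_ifs <;> simp)
    funext k
    obtain ⟨c, hc⟩ := hw.exists_mem k
    have := congrFun hf c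
    simpa [hc, hw.injective.eq_iff] using this
  have hcard : Fintype.card Q ≤ 4 := by
    have := (ncard_range_charSum_le C w).trans hrows
    rwa [← Nat.card_coe_set_eq, Nat.card_eq_fintype_card] at this
  have hsurj : Function.Surjective T := by
    refine (LinearMap.injective_iff_surjective_of_finrank_eq_finrank ?_).mp hinj
    refine le_antisymm (LinearMap.finrank_le_finrank_of_injective hinj) ?_
    simpa using hcard
  obtain ⟨a, ha⟩ := hsurj fun q => (q : Fin 4 → ℚ) i * (q : Fin 4 → ℚ) j
  exact ⟨a, fun x => (congrFun ha ⟨_, x, rfl⟩).symm⟩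

/-- The number of ways to write a codeword as a sum of codewords of weights `w i` and `w j` depends
only on the weight of the codeword. -/
theorem exists_card_decomposition {n : ℕ} {C : Submodule (ZMod 2) (Word n)} [Fintype C]
    {w : Fin 4 → ℕ} (hw : IsThreeWeight C w) (hrows : numDistinctRows (dualCode C) ≤ 4)
    (i j : Fin 4) :
    ∃ a : Fin 4 → ℕ, ∀ k, ∀ c : C, hammingNorm (c : Word n) = w k →
      (Finset.univ.filter fun z : C => hammingNorm (z : Word n) = w i ∧
        hammingNorm ((c - z : C) : Word n) = w j).card = a k := by
  obtain ⟨a, ha⟩ := exists_charSum_mul_eq hw hrows i j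
  let F : C → ℕ := fun c => (Finset.univ.filter fun z : C => hammingNorm (z : Word n) = w i ∧
        hammingNorm ((c - z : C) : Word n) = w j).card
  -- The convolution of two weight classes has the product of their character sums as transform.
  have hconv : ∀ x : Word n, ∑ c : C, (F c : ℚ) * signChar (x ⬝ᵥ (c : Word n)) =
      charSum C (w i) x * charSum C (w j) x := by
    intro x
    unfold charSum
    rw [Finset.sum_mul]
    have h1 : ∀ c : C, (F c : ℚ) * signChar (x ⬝ᵥ (c : Word n)) = ∑ z : C,
        if hammingNorm (z : Word n) = w i ∧ hammingNorm ((c - z : C) : Word n) = w j then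
          signChar (x ⬝ᵥ (c : Word n)) else 0 := by
      intro c
      rw [← Finset.sum_filter, Finset.sum_const, nsmul_eq_mul]
    simp_rw [h1]
    rw [Finset.sum_comm]
    refine Finset.sum_congr rfl fun z _ => ?_
    rw [← Equiv.sum_comp (Equiv.addRight z), Finset.mul_sum]
    refine Finset.sum_congr rfl fun c _ => ?_
    simp only [Equiv.coe_addRight, add_sub_cancel_right, Submodule.coe_add, dotProduct_add,
      signChar_add, ite_and]
    split_ifs <;> simp [mul_comm]
  have hf := eq_zero_of_fourier_eq_zero C
    (fun c => (F c : ℚ) - ∑ k, if hammingNorm (c : Word n) = w k then a k else 0) (fun x => by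
      simp_rw [sub_mul]
      rw [Finset.sum_sub_distrib, hconv, ha, sub_eq_zero]
      simp only [charSum, Finset.mul_sum]
      rw [Finset.sum_comm]
      refine Finset.sum_congr rfl fun c _ => ?_
      rw [Finset.sum_mul]
      refine Finset.sum_congr rfl fun k _ => ?_
      split_ifs <;> simp)
  have hF : ∀ k, ∀ c : C, hammingNorm (c : Word n) = w k → (F c : ℚ) = a k := by
    intro k c hc
    have := congrFun hf c
    simp only [Pi.zero_apply, hc, hw.injective.eq_iff] at this
    simpa [sub_eq_zero] using this
  choose r hr using fun k => hw.exists_mem k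
  refine ⟨fun k => F (r k), fun k c hc => ?_⟩
  have := (hF k c hc).trans (hF k _ (hr k)).symm
  exact_mod_cast this

theorem exists_isAssociationScheme {n : ℕ} {C : Submodule (ZMod 2) (Word n)} {w : Fin 4 → ℕ}
    (hw : IsThreeWeight C w) (hrows : numDistinctRows (dualCode C) ≤ 4) :
    ∃ p, IsAssociationScheme (distanceScheme C w) p := by
  classical
  choose p hp using exists_card_decomposition hw hrows
  refine ⟨p, inferInstance, fun x y => ?_, fun i => ?_, fun x y => ?_, fun i x y => ?_,
    fun i j k x y hxy => ?_⟩
  · obtain ⟨i, hi⟩ := hw.exists_weight (x - y)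
    have h : hammingDist (x : Word n) (y : Word n) = w i := by
      rw [hammingDist_eq_hammingNorm_sub]; exact hi
    exact ⟨i, h, fun j hj => hw.injective (hj.symm.trans h)⟩
  · obtain ⟨c, hc⟩ := hw.exists_mem i
    exact ⟨c, 0, by simpa [distanceScheme] using hc⟩
  · simp [distanceScheme, hw.zero]
  · simp [distanceScheme, hammingDist_comm]
  · have hxy' : hammingNorm ((x - y : C) : Word n) = w k := by
      rw [← hxy, hammingDist_eq_hammingNorm_sub]; rfl
    rw [← hp i j k _ hxy', ← Set.ncard_coe_finset]
    refine Set.ncard_congr (fun z _ => x - z) ?_ ?_ ?_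
    · rintro z ⟨h1, h2⟩
      unfold distanceScheme at h1 h2
      rw [hammingDist_eq_hammingNorm_sub] at h1 h2
      simpa using ⟨h1, h2⟩
    · intro z z' _ _ h
      simpa using h
    · intro z hz
      refine ⟨x - z, ?_, by simp⟩
      simp only [Finset.coe_filter, Finset.mem_univ, true_and, Set.mem_ofPred_eq] at hz
      constructor
      · unfold distanceScheme
        rw [hammingDist_eq_hammingNorm_sub]
        simpa using hz.1
      · unfold distanceScheme
        rw [hammingDist_eq_hammingNorm_sub, ← hz.2]
        congr 1
        simp only [Submodule.coe_sub]
        exact sub_right_comm _ _ _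

/-! ### Triangles with prescribed distances -/

/-- The number of triangles `0, x, y` in `C` with `x`, `y` and `x - y` of weights `w i`, `w j`
and `w k`. -/
def triangleCount {n : ℕ} (C : Submodule (ZMod 2) (Word n)) [Fintype C] (w : Fin 4 → ℕ)
    (i j k : Fin 4) : ℕ :=
  (Finset.univ.filter fun q : C × C => hammingNorm (q.1 : Word n) = w i ∧
    hammingNorm (q.2 : Word n) = w j ∧ hammingDist (q.1 : Word n) (q.2 : Word n) = w k).card

theorem triangleCount_swap {n : ℕ} (C : Submodule (ZMod 2) (Word n)) [Fintype C] (w : Fin 4 → ℕ)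
    (i j k : Fin 4) : triangleCount C w i j k = triangleCount C w j i k := by
  refine Finset.card_equiv (Equiv.prodComm C C) fun q => ?_
  simp only [Finset.mem_filter, Finset.mem_univ, true_and, Equiv.prodComm_apply, Prod.fst_swap,
    Prod.snd_swap, hammingDist_comm (q.2 : Word n)]
  tauto

theorem triangleCount_rotate {n : ℕ} (C : Submodule (ZMod 2) (Word n)) [Fintype C]
    (w : Fin 4 → ℕ) (i j k : Fin 4) : triangleCount C w i j k = triangleCount C w i k j := by
  refine Finset.card_equiv (Equiv.prodShear (Equiv.refl C) fun x => Equiv.subLeft x) fun q => ?_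
  simp only [Finset.mem_filter, Finset.mem_univ, true_and, Equiv.prodShear_apply,
    hammingDist_eq_hammingNorm_sub, Equiv.refl_apply, Equiv.subLeft_apply, Submodule.coe_sub,
    sub_sub_cancel]
  tauto

theorem weightCount_eq_card {n : ℕ} (C : Submodule (ZMod 2) (Word n)) [Fintype C] (m : ℕ) :
    weightCount (C : Set (Word n)) m =
      (Finset.univ.filter fun c : C => hammingNorm (c : Word n) = m).card := by
  unfold weightCount
  rw [← Set.ncard_coe_finset]
  symm
  exact Set.ncard_congr (fun c _ => (c : Word n)) (fun c hc => ⟨c.2, by simpa using hc⟩)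
    (fun a b _ _ h => Subtype.ext h) (fun u hu => ⟨⟨u, hu.1⟩, by simpa using hu.2, rfl⟩)

/-- Counting the triangles `0, z, u` by the vertex `u` of weight `w k`. -/
theorem triangleCount_eq_mul {n : ℕ} {C : Submodule (ZMod 2) (Word n)} [Fintype C]
    {w : Fin 4 → ℕ} {p : Fin 4 → Fin 4 → Fin 4 → ℕ}
    (hp : IsAssociationScheme (distanceScheme C w) p) (i j k : Fin 4) :
    triangleCount C w i k j = weightCount (C : Set (Word n)) (w k) * p i j k := by
  classical
  have h : ∀ u ∈ Finset.univ.filter fun c : C => hammingNorm (c : Word n) = w k,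
      (Finset.univ.filter fun q : C × C => (hammingNorm (q.1 : Word n) = w i ∧
        hammingNorm (q.2 : Word n) = w k ∧ hammingDist (q.1 : Word n) (q.2 : Word n) = w j) ∧
          q.2 = u).card = p i j k := by
    intro u hu
    have hu' : hammingNorm (u : Word n) = w k := by simpa using hu
    have h0 : distanceScheme C w k 0 u := by
      simpa [distanceScheme] using hu'
    rw [← hp.intersection i j k 0 u h0, ← Set.ncard_coe_finset]
    refine Set.ncard_congr (fun q _ => q.1) ?_ ?_ ?_
    · rintro ⟨z, u'⟩ hq
      simp only [Finset.coe_filter, Finset.mem_univ, true_and, Set.mem_ofPred_eq] at hq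
      obtain ⟨⟨h1, -, h3⟩, rfl⟩ := hq
      exact ⟨by simpa [distanceScheme] using h1, h3⟩
    · rintro ⟨z, u₁⟩ ⟨z', u₂⟩ h1 h2 rfl
      simp only [Finset.coe_filter, Finset.mem_univ, true_and, Set.mem_ofPred_eq] at h1 h2
      rw [h1.2, h2.2]
    · rintro z ⟨h1, h2⟩
      refine ⟨(z, u), ?_, rfl⟩
      simp only [Finset.coe_filter, Finset.mem_univ, true_and, Set.mem_ofPred_eq, and_true]
      exact ⟨by simpa [distanceScheme] using h1, hu', h2⟩
  rw [weightCount_eq_card, triangleCount, Finset.card_eq_sum_card_fiberwise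
    (f := fun q : C × C => q.2)
    (t := Finset.univ.filter fun c : C => hammingNorm (c : Word n) = w k)]
  · simp_rw [Finset.filter_filter]
    rw [Finset.sum_congr rfl h, Finset.sum_const, smul_eq_mul]
  · intro q hq
    simp only [Finset.coe_filter, Finset.mem_univ, true_and, Set.mem_ofPred_eq] at hq ⊢
    exact hq.2.1

theorem sum_triangleCount {n : ℕ} {C : Submodule (ZMod 2) (Word n)} [Fintype C]
    {w : Fin 4 → ℕ} (hw : IsThreeWeight C w) (i j : Fin 4) :
    ∑ k, triangleCount C w i j k =
      weightCount (C : Set (Word n)) (w i) * weightCount (C : Set (Word n)) (w j) := by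
  classical
  choose wt hwt using fun q : C × C => hw.exists_weight (q.1 - q.2)
  rw [weightCount_eq_card, weightCount_eq_card, ← Finset.card_product,
    Finset.card_eq_sum_card_fiberwise (f := wt) (t := Finset.univ) (by simp)]
  refine Finset.sum_congr rfl fun k _ => ?_
  unfold triangleCount
  congr 1
  ext q
  have : hammingDist (q.1 : Word n) (q.2 : Word n) = w (wt q) := by
    rw [hammingDist_eq_hammingNorm_sub, ← hwt q, Submodule.coe_sub]
  simp only [Finset.mem_filter, Finset.mem_univ, true_and, Finset.mem_product, this,
    hw.injective.eq_iff]
  tauto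

theorem triangleCount_zero_right {n : ℕ} {C : Submodule (ZMod 2) (Word n)} [Fintype C]
    {w : Fin 4 → ℕ} (hw : IsThreeWeight C w) {i j : Fin 4} (hij : i ≠ j) :
    triangleCount C w i j 0 = 0 := by
  unfold triangleCount
  rw [Finset.card_eq_zero, Finset.filter_eq_empty_iff]
  rintro q - ⟨h1, h2, h3⟩
  rw [hw.zero, hammingDist_eq_zero] at h3
  rw [h3] at h1
  exact hij (hw.injective (h1.symm.trans h2))

/-! ### Bidistances -/

theorem d10_add_d01 {n : ℕ} (x y : Word n) : d10 x y + d01 x y = hammingDist x y := by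
  unfold d10 d01 hammingDist
  rw [← Finset.card_union_of_disjoint, ← Finset.filter_or]
  · congr 1
    ext i
    simp only [Finset.mem_filter, Finset.mem_univ, true_and]
    generalize x i = a
    generalize y i = b
    revert a b
    decide
  · rw [Finset.disjoint_filter]
    rintro i - ⟨h, -⟩ ⟨h', -⟩
    rw [h] at h'
    exact one_ne_zero h'

theorem d01_swap {n : ℕ} (x y : Word n) : d01 x y = d10 y x := by
  unfold d01 d10
  simp only [and_comm]

theorem hammingNorm_eq_d10_add {n : ℕ} (x y : Word n) :
    hammingNorm x = d10 x y + (Finset.univ.filter fun i => x i = 1 ∧ y i = 1).card := by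
  unfold d10 hammingNorm
  rw [← Finset.card_union_of_disjoint, ← Finset.filter_or]
  · have h : ∀ a b : ZMod 2, a ≠ 0 ↔ a = 1 ∧ b = 0 ∨ a = 1 ∧ b = 1 := by decide
    congr 1
    ext i
    simpa only [Finset.mem_filter, Finset.mem_univ, true_and] using h (x i) (y i)
  · rw [Finset.disjoint_filter]
    rintro i - ⟨-, h⟩ ⟨-, h'⟩
    rw [h] at h'
    exact zero_ne_one h'

theorem hammingNorm_add_d01 {n : ℕ} (x y : Word n) :
    hammingNorm x + d01 x y = hammingNorm y + d10 x y := by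
  rw [hammingNorm_eq_d10_add x y, hammingNorm_eq_d10_add y x, d01_swap]
  simp only [and_comm (a := x _ = 1)]
  omega

/-- The bidistance of two words of weights `w i` and `w j` at distance `w k`. -/
def triangleBidistance (w : Fin 4 → ℕ) (i j k : Fin 4) : ℚ × ℚ :=
  (((w k : ℚ) + w i - w j) / 2, ((w k : ℚ) + w j - w i) / 2)

theorem bidistance_eq_triangleBidistance {n : ℕ} {x y : Word n} {w : Fin 4 → ℕ} {i j k : Fin 4}
    (hx : hammingNorm x = w i) (hy : hammingNorm y = w j) (hxy : hammingDist x y = w k) :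
    ((d10 x y : ℚ), (d01 x y : ℚ)) = triangleBidistance w i j k := by
  have h1 := d10_add_d01 x y
  have h2 := hammingNorm_add_d01 x y
  rw [hxy] at h1
  rw [hx, hy] at h2
  have h1' : (d10 x y : ℚ) + d01 x y = w k := by exact_mod_cast h1
  have h2' : (w i : ℚ) + d01 x y = w j + d10 x y := by exact_mod_cast h2
  unfold triangleBidistance
  ext <;> simp only <;> linarith

theorem exists_nat_triangleBidistance {n : ℕ} {C : Submodule (ZMod 2) (Word n)} [Fintype C]
    {w : Fin 4 → ℕ} {i j k : Fin 4} (h : triangleCount C w i j k ≠ 0) :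
    ∃ a b : ℕ, triangleBidistance w i j k = ((a : ℚ), (b : ℚ)) := by
  obtain ⟨q, hq⟩ := Finset.card_ne_zero.mp h
  simp only [Finset.mem_filter, Finset.mem_univ, true_and] at hq
  exact ⟨_, _, (bidistance_eq_triangleBidistance hq.1 hq.2.1 hq.2.2).symm⟩

theorem bidistanceFreq_eq_card {n : ℕ} (C : Submodule (ZMod 2) (Word n)) [Fintype C] (a b : ℕ) :
    bidistanceFreq ((C : Set (Word n)) \ {0}) a b =
      (Finset.univ.filter fun q : C × C => (q.1 : Word n) ≠ 0 ∧ (q.2 : Word n) ≠ 0 ∧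
        bidistance (q.1 : Word n) (q.2 : Word n) = (a, b)).card := by
  unfold bidistanceFreq
  rw [← Set.ncard_coe_finset]
  symm
  refine Set.ncard_congr (fun q _ => ((q.1 : Word n), (q.2 : Word n))) ?_ ?_ ?_
  · rintro ⟨x, y⟩ h
    simp only [Finset.coe_filter, Finset.mem_univ, true_and, Set.mem_ofPred_eq] at h
    exact ⟨⟨x.2, h.1⟩, ⟨y.2, h.2.1⟩, h.2.2⟩
  · rintro ⟨x, y⟩ ⟨x', y'⟩ - - h
    rw [Prod.mk.injEq] at h
    exact Prod.ext (Subtype.ext h.1) (Subtype.ext h.2)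
  · rintro ⟨x, y⟩ ⟨⟨hx, hx0⟩, ⟨hy, hy0⟩, h⟩
    refine ⟨(⟨x, hx⟩, ⟨y, hy⟩), ?_, rfl⟩
    simp only [Finset.coe_filter, Finset.mem_univ, true_and, Set.mem_ofPred_eq]
    exact ⟨hx0, hy0, h⟩

/-- The pairs of nonzero codewords with bidistance `(a, b)`, counted by the two weights and the
distance, none of which is zero. -/
theorem bidistanceFreq_eq_sum {n : ℕ} {C : Submodule (ZMod 2) (Word n)} [Fintype C]
    {w : Fin 4 → ℕ} (hw : IsThreeWeight C w) {a b : ℕ} (hab : (a, b) ≠ (0, 0)) :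
    bidistanceFreq ((C : Set (Word n)) \ {0}) a b = ∑ i : Fin 3, ∑ j : Fin 3, ∑ k : Fin 3,
      if triangleBidistance w i.succ j.succ k.succ = ((a : ℚ), (b : ℚ)) then
        triangleCount C w i.succ j.succ k.succ else 0 := by
  classical
  have hsucc : ∀ c : C, (c : Word n) ≠ 0 → ∃ i : Fin 3, hammingNorm (c : Word n) = w i.succ := by
    intro c hc
    obtain ⟨i, hi⟩ := hw.exists_weight c
    refine Fin.cases (fun h0 => ?_) (fun i hi => ⟨i, hi⟩) i hi
    rw [hw.zero, hammingNorm_eq_zero] at h0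
    exact absurd h0 hc
  have hne : ∀ {u : Word n} {i : Fin 3}, hammingNorm u = w i.succ → u ≠ 0 := by
    rintro u i h rfl
    rw [hammingNorm_zero, ← hw.zero] at h
    exact (Fin.succ_ne_zero i) (hw.injective h).symm
  rw [bidistanceFreq_eq_card]
  simp only [← Fintype.sum_prod_type']
  let E : Fin 3 × Fin 3 × Fin 3 → Finset (C × C) := fun t => Finset.univ.filter fun q =>
    triangleBidistance w t.1.succ t.2.1.succ t.2.2.succ = ((a : ℚ), (b : ℚ)) ∧
    hammingNorm (q.1 : Word n) = w t.1.succ ∧ hammingNorm (q.2 : Word n) = w t.2.1.succ ∧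
      hammingDist (q.1 : Word n) (q.2 : Word n) = w t.2.2.succ
  have hE : ∀ t, (E t).card =
      if triangleBidistance w t.1.succ t.2.1.succ t.2.2.succ = ((a : ℚ), (b : ℚ)) then
        triangleCount C w t.1.succ t.2.1.succ t.2.2.succ else 0 := by
    intro t
    split_ifs with h <;> simp [E, h, triangleCount]
  simp_rw [← hE]
  rw [← Finset.card_biUnion]
  · congr 1
    ext q
    simp only [Finset.mem_filter, Finset.mem_univ, true_and, Finset.mem_biUnion, E]
    constructor
    · rintro ⟨h1, h2, h3⟩
      obtain ⟨i, hi⟩ := hsucc _ h1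
      obtain ⟨j, hj⟩ := hsucc _ h2
      have h4 : ((q.1 - q.2 : C) : Word n) ≠ 0 := by
        intro h0
        have h5 := d10_add_d01 (q.1 : Word n) (q.2 : Word n)
        rw [hammingDist_eq_hammingNorm_sub, ← Submodule.coe_sub, h0, hammingNorm_zero] at h5
        refine hab (h3.symm.trans ?_)
        simp only [bidistance, Prod.mk.injEq]
        omega
      obtain ⟨k, hk⟩ := hsucc _ h4
      rw [Submodule.coe_sub, ← hammingDist_eq_hammingNorm_sub] at hk
      refine ⟨(i, j, k), ?_, hi, hj, hk⟩
      simp only [bidistance, Prod.mk.injEq] at h3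
      rw [← bidistance_eq_triangleBidistance hi hj hk, h3.1, h3.2]
    · rintro ⟨t, h0, h1, h2, h3⟩
      refine ⟨hne h1, hne h2, ?_⟩
      rw [← bidistance_eq_triangleBidistance h1 h2 h3] at h0
      simpa [bidistance] using h0
  · intro t _ t' _ htt'
    rw [Function.onFun, Finset.disjoint_left]
    intro q hq hq'
    simp only [Finset.mem_filter, Finset.mem_univ, true_and, E] at hq hq'
    have e : ∀ {i j : Fin 3} {m : ℕ}, m = w i.succ → m = w j.succ → i = j := fun h h' =>
      Fin.succ_injective _ (hw.injective (h.symm.trans h'))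
    exact htt' (Prod.ext (e hq.2.1 hq'.2.1)
      (Prod.ext (e hq.2.2.1 hq'.2.2.1) (e hq.2.2.2 hq'.2.2.2)))

theorem bidistanceFreq_zero {n : ℕ} {C : Submodule (ZMod 2) (Word n)} [Fintype C]
    {w : Fin 4 → ℕ} (hw : IsThreeWeight C w) :
    bidistanceFreq ((C : Set (Word n)) \ {0}) 0 0 = weightCount (C : Set (Word n)) (w 1) +
      weightCount (C : Set (Word n)) (w 2) + weightCount (C : Set (Word n)) (w 3) := by
  classical
  choose wt hwt using hw.exists_weight
  have h0 : ∀ c : C, (c : Word n) ≠ 0 ↔ wt c ≠ 0 := by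
    intro c
    rw [← hammingNorm_ne_zero_iff, hwt, ← hw.injective.ne_iff (x := wt c), hw.zero]
  have h1 : bidistanceFreq ((C : Set (Word n)) \ {0}) 0 0 =
      (Finset.univ.filter fun c : C => (c : Word n) ≠ 0).card := by
    rw [bidistanceFreq_eq_card]
    symm
    refine Finset.card_bij (fun c _ => (c, c)) ?_ (fun c _ c' _ h => (Prod.ext_iff.mp h).1) ?_
    · intro c hc
      have h2 := d10_add_d01 (c : Word n) (c : Word n)
      rw [hammingDist_self] at h2
      simp only [Finset.mem_filter, Finset.mem_univ, true_and, bidistance, Prod.mk.injEq] at hc ⊢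
      exact ⟨hc, hc, by omega, by omega⟩
    · rintro ⟨x, y⟩ h
      simp only [Finset.mem_filter, Finset.mem_univ, true_and, bidistance, Prod.mk.injEq] at h
      have h2 := d10_add_d01 (x : Word n) (y : Word n)
      rw [h.2.2.1, h.2.2.2] at h2
      have h3 : x = y := Subtype.ext (hammingDist_eq_zero.mp h2.symm)
      subst h3
      exact ⟨x, by simpa using h.1, rfl⟩
  rw [h1, Finset.card_eq_sum_card_fiberwise (f := wt) (t := {1, 2, 3})]
  · have h2 : ∀ i : Fin 4, i ≠ 0 →
        ((Finset.univ.filter fun c : C => (c : Word n) ≠ 0).filter fun c => wt c = i).card =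
          weightCount (C : Set (Word n)) (w i) := by
      intro i hi
      rw [weightCount_eq_card, Finset.filter_filter]
      congr 1
      ext c
      simp only [Finset.mem_filter, Finset.mem_univ, true_and, h0, hwt, hw.injective.eq_iff]
      exact ⟨fun h => h.2, fun h => ⟨h ▸ hi, h⟩⟩
    rw [Finset.sum_insert (by decide), Finset.sum_insert (by decide), Finset.sum_singleton,
      h2 1 (by decide), h2 2 (by decide), h2 3 (by decide), add_assoc]
  · intro c hc
    have h2 : ∀ i : Fin 4, i ≠ 0 → i ∈ ({1, 2, 3} : Finset (Fin 4)) := by decide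
    exact h2 _ ((h0 c).mp (by simpa using hc))

/-! ### The table -/

theorem tableFreq_nil (a b : ℕ) : tableFreq [] a b = 0 := rfl

theorem tableFreq_cons (r : (ℚ × ℚ) × ℤ) (T : List ((ℚ × ℚ) × ℤ)) (a b : ℕ) :
    tableFreq (r :: T) a b = (if r.1 = ((a : ℚ), (b : ℚ)) then r.2 else 0) + tableFreq T a b := by
  unfold tableFreq
  rw [List.filter_cons]
  split_ifs <;> simp_all

theorem tableFreq_append (T T' : List ((ℚ × ℚ) × ℤ)) (a b : ℕ) :
    tableFreq (T ++ T') a b = tableFreq T a b + tableFreq T' a b := by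
  simp [tableFreq]

theorem triangleBidistance_self (w : Fin 4 → ℕ) (i k : Fin 4) :
    triangleBidistance w i i k = ((w k : ℚ) / 2, (w k : ℚ) / 2) := by
  simp [triangleBidistance]

theorem triangleBidistance_swap (w : Fin 4 → ℕ) (i j k : Fin 4) :
    (triangleBidistance w i j k).swap = triangleBidistance w j i k := rfl

theorem diagonalRows_eq (w v : Fin 4 → ℕ) (p : Fin 4 → Fin 4 → Fin 4 → ℕ)
    (t : Fin 4 → Fin 4 → Fin 4 → ℕ) (htp : ∀ i j k, t i k j = v k * p i j k)
    (hswap : ∀ i j k, t i j k = t j i k) (hrot : ∀ i j k, t i j k = t i k j) :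
    diagonalRows w v p =
      [(((w 1 : ℚ) / 2, (w 1 : ℚ) / 2), (t 1 1 1 : ℤ) + t 2 2 1 + t 3 3 1),
        (((w 2 : ℚ) / 2, (w 2 : ℚ) / 2), (t 1 1 2 : ℤ) + t 2 2 2 + t 3 3 2),
        (((w 3 : ℚ) / 2, (w 3 : ℚ) / 2), (t 1 1 3 : ℤ) + t 2 2 3 + t 3 3 3)] := by
  have h : ∀ i j k, (v k : ℤ) * p i j k = t i k j := fun i j k => by
    rw [htp, Nat.cast_mul]
  simp only [diagonalRows, h]
  rw [hswap 1 2 2, hrot 2 1 2, hswap 1 3 3, hrot 3 1 3, hswap 2 3 3, hrot 3 2 3]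

/-- The weights and the distance of the pairs counted in the nine rows of `offDiagonalRows`. -/
def offDiagonalTriples : List (Fin 4 × Fin 4 × Fin 4) :=
  [(1, 2, 3), (1, 3, 2), (2, 3, 1), (1, 2, 1), (1, 3, 1), (1, 2, 2), (1, 3, 3), (2, 3, 2),
    (2, 3, 3)]

theorem offDiagonalRows_eq (w v : Fin 4 → ℕ) (p : Fin 4 → Fin 4 → Fin 4 → ℕ)
    (t : Fin 4 → Fin 4 → Fin 4 → ℕ) (htp : ∀ i j k, t i k j = v k * p i j k)
    (hswap : ∀ i j k, t i j k = t j i k) (hrot : ∀ i j k, t i j k = t i k j)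
    (hsum : ∑ k, t 1 2 k = v 1 * v 2) (hzero : t 1 2 0 = 0) :
    offDiagonalRows w v p = offDiagonalTriples.map fun s =>
      (triangleBidistance w s.1 s.2.1 s.2.2, (t s.1 s.2.1 s.2.2 : ℤ)) := by
  have h : ∀ i j k, (v k : ℤ) * p i j k = t i k j := fun i j k => by
    rw [htp, Nat.cast_mul]
  -- The frequency of the scalene triangles is what the isosceles ones leave of all `v₁ v₂` pairs.
  have h123 : (v 1 : ℤ) * v 2 - t 1 1 2 - t 1 2 2 = t 1 2 3 := by
    rw [Fin.sum_univ_four, hzero, hrot 1 2 1] at hsum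
    have : ((0 + t 1 1 2 + t 1 2 2 + t 1 2 3 : ℕ) : ℤ) = (v 1 * v 2 : ℕ) := by rw [hsum]
    push_cast at this
    linarith
  simp only [offDiagonalRows, h, h123, offDiagonalTriples, List.map_cons, List.map_nil,
    triangleBidistance]
  rw [hrot 1 3 2, hswap 2 3 1, hrot 3 2 1, hswap 3 1 2, hrot 1 3 2, hrot 1 2 1, hrot 1 3 1,
    hrot 2 3 2]
  refine congrArg₂ _ ?_ (congrArg₂ _ ?_ (congrArg₂ _ ?_ (congrArg₂ _ ?_ (congrArg₂ _ ?_
    (congrArg₂ _ ?_ (congrArg₂ _ ?_ (congrArg₂ _ ?_ (congrArg₂ _ ?_ rfl))))))))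
  all_goals
    refine congrArg₂ _ (congrArg₂ _ ?_ ?_) rfl <;> ring

end BinaryCode

open BinaryCode in
theorem mainTheorem3 (n : ℕ) (C : Submodule (ZMod 2) (Word n)) (w : Fin 4 → ℕ)
    (hproj : IsProjective C) (hw : IsThreeWeight C w)
    (hrows : numDistinctRows (dualCode C) = 4) :
    (∃ p, IsAssociationScheme (distanceScheme C w) p) ∧
    ∀ (v : Fin 4 → ℕ) (p : Fin 4 → Fin 4 → Fin 4 → ℕ),
      (∀ i, v i = weightCount (C : Set (Word n)) (w i)) →
      IsAssociationScheme (distanceScheme C w) p →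
      (∀ i, p i i 0 = v i) ∧
      bidistanceFreq ((C : Set (Word n)) \ {0}) 0 0 = v 1 + v 2 + v 3 ∧
      (∀ a b : ℕ, (a, b) ≠ (0, 0) →
        (bidistanceFreq ((C : Set (Word n)) \ {0}) a b : ℤ) =
          tableFreq (bidistanceTable w v p) a b) ∧
      (∀ r ∈ bidistanceTable w v p,
        0 ≤ r.2 ∧ (r.2 ≠ 0 → ∃ a b : ℕ, r.1 = ((a : ℚ), (b : ℚ)))) := by
  classical
  refine ⟨exists_isAssociationScheme hw hrows.le, fun v p hv hp => ?_⟩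
  set t := triangleCount C w with ht
  have htp : ∀ i j k, t i k j = v k * p i j k := fun i j k => by
    rw [hv, ht, triangleCount_eq_mul hp]
  have hswap : ∀ i j k, t i j k = t j i k := triangleCount_swap C w
  have hrot : ∀ i j k, t i j k = t i k j := triangleCount_rotate C w
  have hdiag := diagonalRows_eq w v p t htp hswap hrot
  have hoff := offDiagonalRows_eq w v p t htp hswap hrot
    (by rw [hv, hv, ht, sum_triangleCount hw]) (triangleCount_zero_right hw (by decide))
  have hnat : ∀ i j k, (t i j k : ℤ) ≠ 0 →
      ∃ a b : ℕ, triangleBidistance w i j k = ((a : ℚ), (b : ℚ)) := fun i j k h =>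
    exists_nat_triangleBidistance (C := C) (Nat.cast_ne_zero.mp h)
  refine ⟨fun i => ?_, ?_, fun a b hab => ?_, fun r hr => ?_⟩
  · rw [← hp.intersection i i 0 0 0 ((hp.diagonal 0 0).mpr rfl), hv, weightCount_eq_card,
      ← Set.ncard_coe_finset]
    congr 1
    ext z
    simp [distanceScheme]
  · rw [bidistanceFreq_zero hw, hv, hv, hv]
  · rw [bidistanceFreq_eq_sum hw hab, bidistanceTable, tableFreq_append, tableFreq_append,
      hdiag, hoff]
    simp only [offDiagonalTriples, List.map_cons, List.map_nil, tableFreq_cons, tableFreq_nil,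
      triangleBidistance_swap, ← triangleBidistance_self w 1, Fin.sum_univ_three]
    have e2 : ∀ k, triangleBidistance w 2 2 k = triangleBidistance w 1 1 k := fun k => by
      rw [triangleBidistance_self, triangleBidistance_self]
    have e3 : ∀ k, triangleBidistance w 3 3 k = triangleBidistance w 1 1 k := fun k => by
      rw [triangleBidistance_self, triangleBidistance_self]
    have s0 : Fin.succ (0 : Fin 3) = (1 : Fin 4) := rfl
    have s1 : Fin.succ (1 : Fin 3) = (2 : Fin 4) := rfl
    have s2 : Fin.succ (2 : Fin 3) = (3 : Fin 4) := rfl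
    have ite3 : ∀ (P : Prop) [Decidable P] (x y z : ℤ), (if P then x + y + z else 0) =
        (if P then x else 0) + (if P then y else 0) + (if P then z else 0) := by
      intro P _ x y z
      split_ifs <;> simp
    simp only [s0, s1, s2, e2, e3, ite3, ← ht, hswap 2 1, hswap 3 1, hswap 3 2]
    push_cast
    ring
  · rw [bidistanceTable, hdiag, hoff, List.mem_append, List.mem_append] at hr
    rcases hr with (hr | hr) | hr
    · -- A nonzero sum of three triangle counts has a nonzero summand.
      have key : ∀ k, 0 ≤ (t 1 1 k : ℤ) + t 2 2 k + t 3 3 k ∧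
          ((t 1 1 k : ℤ) + t 2 2 k + t 3 3 k ≠ 0 →
            ∃ a b : ℕ, ((w k : ℚ) / 2, (w k : ℚ) / 2) = ((a : ℚ), (b : ℚ))) := by
        intro k
        refine ⟨by positivity, fun h => ?_⟩
        have h' : ∃ i, (t i i k : ℤ) ≠ 0 := by
          by_contra! h0
          exact h (by rw [h0, h0, h0]; rfl)
        obtain ⟨i, hi⟩ := h'
        rw [← triangleBidistance_self w i k]
        exact hnat i i k hi
      simp only [List.mem_cons, List.not_mem_nil, or_false] at hr
      rcases hr with rfl | rfl | rfl
      exacts [key 1, key 2, key 3]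
    · obtain ⟨s, -, rfl⟩ := List.mem_map.mp hr
      exact ⟨by positivity, hnat _ _ _⟩
    · rw [List.map_map] at hr
      obtain ⟨s, -, rfl⟩ := List.mem_map.mp hr
      refine ⟨by simp, fun h => ?_⟩
      obtain ⟨a, b, hab⟩ := hnat _ _ _ h
      exact ⟨b, a, congrArg Prod.swap hab⟩
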